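/- Let $(M^n,g)$ be an oriented and time-oriented Lorentzian spin manifold of signature $(-,+,\dots,+)$, with a fixed spin structure. The Clifford relation is $X\cdot X=-g(X,X)$. Let $S$ be the spinor bundle, i.e. the complex vector bundle associated to the spin structure by the spinor module $\Delta_{1,n-1}=(\mathbb C^2)^{\otimes [n/2]}$, on which an orthonormal basis $e_1,\dots,e_n$ of Minkowski space ($e_1$ timelike) acts as follows. Put $E=\begin{pmatrix}1&0\\0&1\end{pmatrix}$, $T=\begin{pmatrix}0&-i\\i&0\end{pmatrix}$, $g_1=\begin{pmatrix}i&0\\0&-i\end{pmatrix}$, $g_2=\begin{pmatrix}0&i\\i&0\end{pmatrix}$, and $\varepsilon_1=i$, $\varepsilon_k=1$ for $k\ge 2$. For $1\le j\le [n/2]$, $e_{2j-1}$ and $e_{2j}$ act by $\varepsilon_{2j-1}\,E\otimes\cdots\otimes E\otimes g_1\otimes T^{\otimes (j-1)}$ and $\varepsilon_{2j}\,E\otimes\cdots\otimes E\otimes g_2\otimes T^{\otimes (j-1)}$; if $n$ is odd, $e_n$ acts by $i\,T\otimes\cdots\otimes T$. Let $\langle\cdot,\cdot\rangle$ be the indefinite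 Hermitian inner product on $S$ given by $\langle\varphi,\psi\rangle=(e_1\cdot\varphi,\psi)$, where $(\cdot,\cdot)$ is the standard scalar product of $\Delta_{1,n-1}$; it is linear in the first argument and antilinear in the second, and satisfies $\langle X\cdot\varphi,\psi\rangle=\langle\varphi,X\cdot\psi\rangle$. The Dirac current $V_\varphi$ of a spinor $\varphi$ is the tangent vector defined by $g(V_\varphi,X)=-\langle X\cdot\varphi,\varphi\rangle$ for all $X$. A real (resp. quaternionic) structure on $S$ is a smooth, fiberwise antilinear bundle map $S\to S$ over the identity with square $1$ (resp. $-1$). For even $n=2m$, $S^{\pm}\subset S$ are the half spinor bundles, with fiber spanned by the vectors $u(\nu_1)\otimes\cdots\otimes u(\nu_m)$ with $\nu_i\in\{\pm1\}$, $\prod_i\nu_i=\pm1$, where $u(\nu)=\frac1{\sqrt2}\begin{pmatrix}1\\-i\nu\end{pmatrix}$. Then the following holds, for all tangent vectors $X$ and all spinors $\varphi,\psi$ at the same point (hence for all vector fields and spinor fields). 1. If $n=3$, there is a real structure $\tau$ on $S$ with $\tau(X\cdot\varphi)=-X\cdot\tau(\varphi)$ and $\langle\tau\varphi,\tau\psi\rangle=-\langle\psi,\varphi\rangle$.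 Every spinor $\varphi$ satisfies $V_\varphi\cdot\varphi=\langle\varphi,\varphi\rangle\varphi$ and $g(V_\varphi,V_\varphi)=-\langle\varphi,\varphi\rangle^2$. If $\tau(\varphi)=\varphi$, then $V_\varphi$ is lightlike: $g(V_\varphi,V_\varphi)=0$, and $V_\varphi\neq0$ if $\varphi\ne0$. 2. If $n=5$, there is a quaternionic structure $J$ on $S$ with $J(X\cdot\varphi)=X\cdot J(\varphi)$ and $\langle J\varphi,J\psi\rangle=\langle\psi,\varphi\rangle$. Every spinor $\varphi$ satisfies $V_\varphi\cdot\varphi=\langle\varphi,\varphi\rangle\varphi$ and $g(V_\varphi,V_\varphi)=-\langle\varphi,\varphi\rangle^2$. 3. If $n=7$, there is a quaternionic structure $J$ on $S$ with $J(X\cdot\varphi)=-X\cdot J(\varphi)$ and $\langle J\varphi,J\psi\rangle=-\langle\psi,\varphi\rangle$, such that every spinor $\varphi$ satisfies $V_\varphi\cdot\varphi=\langle\varphi,\varphi\rangle\varphi+\langle\varphi,J\varphi\rangle J\varphi$ and $|\langle\varphi,\varphi\rangle|^2+|\langle\varphi,J\varphi\rangle|^2=-g(V_\varphi,V_\varphi)$.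 4. If $n\in\{2,4,6\}$, every half spinor $\varphi\in S^{\pm}$ satisfies $V_\varphi\cdot\varphi=0$ and $g(V_\varphi,V_\varphi)=0$, and $V_\varphi\neq0$ if $\varphi\neq0$. -/

import Mathlib

open scoped Manifold ContDiff Bundle Matrix

noncomputable section

namespace LorentzSpin

/-! ### Minkowski space and its Clifford algebra -/

/-- The diagonal entries `-1, 1, ..., 1` of the Minkowski metric; the index `0` is timelike. -/
def eta {n : ℕ} (a : Fin n) : ℝ := if a.val = 0 then -1 else 1

/-- The quadratic form `v ↦ -⟨v, v⟩` of Minkowski space: in its Clifford algebra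
`v * v = -⟨v, v⟩`, so that the timelike unit vector has square `+1`. -/
def cliffordForm (n : ℕ) : QuadraticForm ℝ (Fin n → ℝ) :=
  QuadraticMap.weightedSumSquares ℝ (fun a : Fin n => -eta a)

/-- The real Clifford algebra of Minkowski space with the convention `v * v = -⟨v, v⟩`. -/
abbrev Cl (n : ℕ) : Type := CliffordAlgebra (cliffordForm n)

/-- The group of products of an even number of unit vectors, evenly many of which are timelike;
it is the double cover of the identity component `SO₀(1, n-1)` of the Lorentz group. -/
abbrev Spin (n : ℕ) : Submonoid (Cl n) := spinGroup (cliffordForm n)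

/-! ### The spinor module -/

/-- Basis labels of `ℂ² ⊗ ... ⊗ ℂ²` (`n / 2` factors). The factors are numbered from the right,
number `0` is the rightmost one. -/
abbrev SpinIndex (n : ℕ) : Type := Fin (n / 2) → Fin 2

/-- The spinor module `ℂ² ⊗ ... ⊗ ℂ²` (`n / 2` factors) with its standard scalar product. -/
abbrev Spinor (n : ℕ) : Type := EuclideanSpace ℂ (SpinIndex n)

def matT : Matrix (Fin 2) (Fin 2) ℂ := !![0, -Complex.I; Complex.I, 0]
def matG1 : Matrix (Fin 2) (Fin 2) ℂ := !![Complex.I, 0; 0, -Complex.I]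
def matG2 : Matrix (Fin 2) (Fin 2) ℂ := !![0, Complex.I; Complex.I, 0]

/-- The Kronecker product of a family of `2 × 2` matrices. -/
def kron {m : ℕ} (A : Fin m → Matrix (Fin 2) (Fin 2) ℂ) :
    Matrix (Fin m → Fin 2) (Fin m → Fin 2) ℂ :=
  Matrix.of fun p q => ∏ k, A k (p k) (q k)

/-- The `k`-th tensor factor, counted from the right, of the matrix of the basis vector `e_a`.
With `j = a / 2` it is `T` for `k < j`, it is `g₁` (`a` even) or `g₂` (`a` odd) for `k = j`, and
it is the identity for `k > j`. (If `n` is odd and `a = n - 1` all factors are `T`.) -/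
def gammaFactor (a k : ℕ) : Matrix (Fin 2) (Fin 2) ℂ :=
  if k < a / 2 then matT else if k = a / 2 then (if a % 2 = 0 then matG1 else matG2) else 1

/-- The scalar factor of the matrix of `e_a`: an `i` for the timelike vector `a = 0`, and an `i`
for the last vector if `n` is odd. -/
def gammaScalar (n a : ℕ) : ℂ :=
  (if a = 0 then Complex.I else 1) * (if a / 2 = n / 2 then Complex.I else 1)

/-- The matrix by which the basis vector `e_a` acts on spinors. -/
def gamma {n : ℕ} (a : Fin n) : Matrix (SpinIndex n) (SpinIndex n) ℂ :=
  gammaScalar n a • kron fun k : Fin (n / 2) => gammaFactor a k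

theorem kron_mul {m : ℕ} (A B : Fin m → Matrix (Fin 2) (Fin 2) ℂ) :
    kron A * kron B = kron fun k => A k * B k := by
  ext p q
  simp only [kron, Matrix.mul_apply, Matrix.of_apply, ← Finset.prod_mul_distrib]
  rw [Finset.prod_univ_sum]
  simp

theorem kron_smul {m : ℕ} (c : Fin m → ℂ) (A : Fin m → Matrix (Fin 2) (Fin 2) ℂ) :
    (kron fun k => c k • A k) = (∏ k, c k) • kron A := by
  ext p q
  simp [kron, Finset.prod_mul_distrib]

theorem kron_one {m : ℕ} : kron (fun _ : Fin m => (1 : Matrix (Fin 2) (Fin 2) ℂ)) = 1 := by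
  ext p q
  simp only [kron, Matrix.of_apply, Matrix.one_apply]
  rw [Fintype.prod_ite_zero]
  simp [funext_iff]

theorem kron_conjTranspose {m : ℕ} (A : Fin m → Matrix (Fin 2) (Fin 2) ℂ) :
    (kron A)ᴴ = kron fun k => (A k)ᴴ := by
  ext p q
  simp [kron, Matrix.conjTranspose_apply, Matrix.of_apply]

theorem matT_sq : matT * matT = 1 := by
  ext i j; fin_cases i <;> fin_cases j <;> simp [matT, Matrix.mul_apply, Fin.sum_univ_two]

theorem matG1_sq : matG1 * matG1 = -1 := by
  ext i j; fin_cases i <;> fin_cases j <;> simp [matG1, Matrix.mul_apply, Fin.sum_univ_two]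

theorem matG2_sq : matG2 * matG2 = -1 := by
  ext i j; fin_cases i <;> fin_cases j <;> simp [matG2, Matrix.mul_apply, Fin.sum_univ_two]

theorem matG1_matT : matG1 * matT = (-1 : ℂ) • (matT * matG1) := by
  ext i j; fin_cases i <;> fin_cases j <;> simp [matG1, matT, Matrix.mul_apply, Fin.sum_univ_two]

theorem matG2_matT : matG2 * matT = (-1 : ℂ) • (matT * matG2) := by
  ext i j; fin_cases i <;> fin_cases j <;> simp [matG2, matT, Matrix.mul_apply, Fin.sum_univ_two]

theorem matG1_matG2 : matG1 * matG2 = (-1 : ℂ) • (matG2 * matG1) := by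
  ext i j; fin_cases i <;> fin_cases j <;> simp [matG1, matG2, Matrix.mul_apply, Fin.sum_univ_two]

theorem gammaFactor_sq (a k : ℕ) : gammaFactor a k * gammaFactor a k
    = (if k = a / 2 then (-1 : ℂ) else 1) • (1 : Matrix (Fin 2) (Fin 2) ℂ) := by
  unfold gammaFactor
  split_ifs <;> first | omega | simp [matT_sq, matG1_sq, matG2_sq]

theorem gammaFactor_anticomm {a b : ℕ} (h : a < b) (k : ℕ) :
    gammaFactor a k * gammaFactor b k
      = (if k = a / 2 then (-1 : ℂ) else 1) • (gammaFactor b k * gammaFactor a k) := by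
  unfold gammaFactor
  split_ifs <;> first | omega | simp [matG1_matT, matG2_matT, matG1_matG2]

theorem gammaFactor_conjTranspose (a k : ℕ) : (gammaFactor a k)ᴴ
    = (if k = a / 2 then (-1 : ℂ) else 1) • gammaFactor a k := by
  unfold gammaFactor
  split_ifs <;> first | omega | skip
  all_goals
    ext i j; fin_cases i <;> fin_cases j <;>
      simp [matT, matG1, matG2, Matrix.conjTranspose_apply]

theorem prod_sign {n a : ℕ} :
    (∏ k : Fin (n / 2), if (k : ℕ) = a / 2 then (-1 : ℂ) else 1)
      = if a / 2 < n / 2 then -1 else 1 := by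
  split_ifs with h
  · rw [Finset.prod_eq_single (⟨a / 2, h⟩ : Fin (n / 2))]
    · simp
    · intro b _ hb
      rw [if_neg]
      exact fun hc => hb (Fin.ext hc)
    · simp
  · refine Finset.prod_eq_one fun k _ => ?_
    rw [if_neg]
    have := k.2
    omega

theorem gamma_sq {n : ℕ} (a : Fin n) : gamma a * gamma a = ((-eta a : ℝ) : ℂ) • 1 := by
  unfold gamma
  rw [Matrix.smul_mul, Matrix.mul_smul, kron_mul, smul_smul]
  simp only [gammaFactor_sq]
  rw [kron_smul, kron_one, prod_sign, smul_smul]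
  congr 1
  have ha := a.2
  unfold gammaScalar eta
  split_ifs <;> first | omega | simp

theorem gamma_anticomm {n : ℕ} {a b : Fin n} (h : a ≠ b) :
    gamma a * gamma b = -(gamma b * gamma a) := by
  wlog hab : a < b generalizing a b
  · rw [this h.symm (lt_of_le_of_ne (not_lt.mp hab) h.symm), neg_neg]
  unfold gamma
  rw [Matrix.smul_mul, Matrix.mul_smul, Matrix.smul_mul, Matrix.mul_smul, kron_mul, kron_mul]
  have hab' : (a : ℕ) < b := hab
  simp only [gammaFactor_anticomm hab']
  have hb := b.2
  rw [kron_smul, prod_sign, if_pos (by omega), smul_comm (gammaScalar n a)]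
  simp

theorem gamma_conjTranspose {n : ℕ} (a : Fin n) :
    (gamma a)ᴴ = ((-eta a : ℝ) : ℂ) • gamma a := by
  unfold gamma
  rw [Matrix.conjTranspose_smul, kron_conjTranspose]
  simp only [gammaFactor_conjTranspose]
  rw [kron_smul, prod_sign, smul_smul, smul_smul]
  congr 1
  have ha := a.2
  unfold gammaScalar eta
  split_ifs <;> first | omega | simp

/-- The matrix `∑ v_a e_a` by which a vector of Minkowski space acts on spinors. -/
def gammaVec (n : ℕ) : (Fin n → ℝ) →ₗ[ℝ] Matrix (SpinIndex n) (SpinIndex n) ℂ where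
  toFun v := ∑ a, v a • gamma a
  map_add' v w := by simp [add_smul, Finset.sum_add_distrib]
  map_smul' c v := by simp [Finset.smul_sum, smul_smul]

theorem gammaVec_sq {n : ℕ} (v : Fin n → ℝ) :
    gammaVec n v * gammaVec n v = algebraMap ℝ _ (cliffordForm n v) := by
  have key : gammaVec n v * gammaVec n v
      = ∑ a, ∑ b, (v a * v b) • (gamma a * gamma b) := by
    simp only [gammaVec, LinearMap.coe_mk, AddHom.coe_mk, Finset.sum_mul, Finset.mul_sum,
      Matrix.smul_mul, Matrix.mul_smul, smul_smul]
    rw [Finset.sum_comm]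
    exact Finset.sum_congr rfl fun a _ => Finset.sum_congr rfl fun b _ => by
      rw [mul_comm (v a)]
  have two : (2 : ℝ) • (gammaVec n v * gammaVec n v)
      = (2 : ℝ) • algebraMap ℝ (Matrix (SpinIndex n) (SpinIndex n) ℂ) (cliffordForm n v) := by
    have h1 : (2 : ℝ) • (gammaVec n v * gammaVec n v)
        = ∑ a, ∑ b, (v a * v b) • (gamma a * gamma b + gamma b * gamma a) := by
      simp only [smul_add, Finset.sum_add_distrib]
      rw [two_smul, key]
      congr 1
      rw [Finset.sum_comm]
      simp only [mul_comm]
    have h2 : ∀ a b : Fin n, gamma a * gamma b + gamma b * gamma a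
        = if a = b then (2 * -eta a : ℝ) • (1 : Matrix (SpinIndex n) (SpinIndex n) ℂ) else 0 := by
      intro a b
      split_ifs with h
      · subst h
        rw [gamma_sq, Complex.coe_smul, ← two_smul ℝ, smul_smul]
      · rw [gamma_anticomm h, neg_add_cancel]
    rw [h1]
    simp only [h2, smul_ite, smul_zero, Finset.sum_ite_eq, Finset.mem_univ, if_true]
    rw [cliffordForm, QuadraticMap.weightedSumSquares_apply, Algebra.algebraMap_eq_smul_one,
      Finset.sum_smul, Finset.smul_sum]
    refine Finset.sum_congr rfl fun a _ => ?_
    rw [smul_smul, smul_smul]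
    congr 1
    simp only [smul_eq_mul]
    ring
  exact smul_right_injective _ (two_ne_zero' ℝ) two

/-- The spin representation of the Clifford algebra, as matrices. -/
def spinRep (n : ℕ) : Cl n →ₐ[ℝ] Matrix (SpinIndex n) (SpinIndex n) ℂ :=
  CliffordAlgebra.lift (cliffordForm n) ⟨gammaVec n, gammaVec_sq⟩

/-- The action of an element of the Clifford algebra on spinors. -/
def act {n : ℕ} (A : Cl n) : Spinor n →L[ℂ] Spinor n :=
  Matrix.toEuclideanCLM (𝕜 := ℂ) (spinRep n A)

theorem act_mul {n : ℕ} (A B : Cl n) (φ : Spinor n) : act (A * B) φ = act A (act B φ) := by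
  simp [act]

theorem act_one {n : ℕ} (φ : Spinor n) : act (1 : Cl n) φ = φ := by
  simp [act]

theorem act_add {n : ℕ} (A B : Cl n) (φ : Spinor n) : act (A + B) φ = act A φ + act B φ := by
  simp [act]

theorem act_algebraMap {n : ℕ} (r : ℝ) (φ : Spinor n) :
    act (algebraMap ℝ (Cl n) r) φ = (r : ℂ) • φ := by
  have h1 : spinRep n (algebraMap ℝ (Cl n) r)
      = (r : ℂ) • (1 : Matrix (SpinIndex n) (SpinIndex n) ℂ) := by
    rw [AlgHom.commutes, Algebra.algebraMap_eq_smul_one, Complex.coe_smul]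
  rw [act, h1, map_smul, map_one]
  rfl

/-- The indefinite inner product `⟨φ, ψ⟩ = (e₀ · φ, ψ)` of spinors, linear in `φ` and antilinear
in `ψ`. (Mathlib's `inner` is antilinear in the first slot.) -/
def spinorForm {n : ℕ} [NeZero n] (φ ψ : Spinor n) : ℂ :=
  inner ℂ ψ (Matrix.toEuclideanCLM (𝕜 := ℂ) (gamma (0 : Fin n)) φ)

theorem spinorForm_gamma {n : ℕ} [NeZero n] (a : Fin n) (φ ψ : Spinor n) :
    spinorForm (Matrix.toEuclideanCLM (𝕜 := ℂ) (gamma a) φ) ψ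
      = spinorForm φ (Matrix.toEuclideanCLM (𝕜 := ℂ) (gamma a) ψ) := by
  have h : (Matrix.toEuclideanCLM (𝕜 := ℂ) (gamma a)).adjoint
      = Matrix.toEuclideanCLM (𝕜 := ℂ) (gamma a)ᴴ := by
    rw [← Matrix.star_eq_conjTranspose, map_star, ContinuousLinearMap.star_eq_adjoint]
  unfold spinorForm
  rw [← ContinuousLinearMap.adjoint_inner_right, h, gamma_conjTranspose,
    ← mul_apply_eq_comp, ← mul_apply_eq_comp, ← map_mul, ← map_mul,
    Matrix.smul_mul]
  congr 3
  by_cases ha : a = 0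
  · subst ha
    simp [eta]
  · rw [gamma_anticomm (Ne.symm ha)]
    have : a.val ≠ 0 := fun h0 => ha (Fin.ext h0)
    simp [eta, this]

theorem act_ι {n : ℕ} (v : Fin n → ℝ) (φ : Spinor n) :
    act (CliffordAlgebra.ι (cliffordForm n) v) φ
      = ∑ a, (v a : ℂ) • Matrix.toEuclideanCLM (𝕜 := ℂ) (gamma a) φ := by
  simp only [act, spinRep, CliffordAlgebra.lift_ι_apply, gammaVec, LinearMap.coe_mk,
    AddHom.coe_mk, map_sum, sum_apply]
  refine Finset.sum_congr rfl fun a _ => ?_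
  rw [← Complex.coe_smul, map_smul]
  rfl

theorem spinorForm_add_left {n : ℕ} [NeZero n] (φ φ' ψ : Spinor n) :
    spinorForm (φ + φ') ψ = spinorForm φ ψ + spinorForm φ' ψ := by
  simp [spinorForm]

theorem spinorForm_add_right {n : ℕ} [NeZero n] (φ ψ ψ' : Spinor n) :
    spinorForm φ (ψ + ψ') = spinorForm φ ψ + spinorForm φ ψ' := by
  simp [spinorForm]

theorem spinorForm_sum_smul_left {n : ℕ} [NeZero n] (v : Fin n → ℝ) (φ : Fin n → Spinor n)
    (ψ : Spinor n) :
    spinorForm (∑ a, (v a : ℂ) • φ a) ψ = ∑ a, (v a : ℂ) * spinorForm (φ a) ψ := by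
  simp [spinorForm]

theorem spinorForm_sum_smul_right {n : ℕ} [NeZero n] (v : Fin n → ℝ) (φ : Spinor n)
    (ψ : Fin n → Spinor n) :
    spinorForm φ (∑ a, (v a : ℂ) • ψ a) = ∑ a, (v a : ℂ) * spinorForm φ (ψ a) := by
  simp [spinorForm]

theorem spinorForm_conj {n : ℕ} [NeZero n] (φ ψ : Spinor n) :
    (starRingEnd ℂ) (spinorForm φ ψ) = spinorForm ψ φ := by
  have h := spinorForm_gamma (0 : Fin n)
  have hA : (Matrix.toEuclideanCLM (𝕜 := ℂ) (gamma (0 : Fin n))).adjoint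
      = Matrix.toEuclideanCLM (𝕜 := ℂ) (gamma (0 : Fin n)) := by
    rw [← ContinuousLinearMap.star_eq_adjoint, ← map_star, Matrix.star_eq_conjTranspose,
      gamma_conjTranspose]
    simp [eta]
  unfold spinorForm
  rw [inner_conj_symm, ← ContinuousLinearMap.adjoint_inner_right, hA]

/-- Clifford multiplication by a vector is symmetric for the indefinite inner product. -/
theorem spinorForm_act_ι {n : ℕ} [NeZero n] (v : Fin n → ℝ) (φ ψ : Spinor n) :
    spinorForm (act (CliffordAlgebra.ι (cliffordForm n) v) φ) ψ
      = spinorForm φ (act (CliffordAlgebra.ι (cliffordForm n) v) ψ) := by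
  rw [act_ι, act_ι, spinorForm_sum_smul_left, spinorForm_sum_smul_right]
  simp only [spinorForm_gamma]

theorem spinorForm_act {n : ℕ} [NeZero n] (A : Cl n) : ∀ φ ψ : Spinor n,
    spinorForm (act A φ) ψ = spinorForm φ (act (CliffordAlgebra.reverse A) ψ) := by
  induction A using CliffordAlgebra.induction with
  | algebraMap r =>
    intro φ ψ
    rw [CliffordAlgebra.reverse.commutes, act_algebraMap, act_algebraMap]
    simp [spinorForm]
  | ι v =>
    intro φ ψ
    rw [CliffordAlgebra.reverse_ι, spinorForm_act_ι]
  | mul A B hA hB =>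
    intro φ ψ
    rw [act_mul, hA, hB, CliffordAlgebra.reverse.map_mul, act_mul]
  | add A B hA hB =>
    intro φ ψ
    rw [map_add, act_add, act_add, spinorForm_add_left, spinorForm_add_right, hA, hB]

/-- The indefinite inner product is invariant under the spin group. -/
theorem spinorForm_spin {n : ℕ} [NeZero n] (A : Spin n) (φ ψ : Spinor n) :
    spinorForm (act (A : Cl n) φ) (act (A : Cl n) ψ) = spinorForm φ ψ := by
  have h1 : CliffordAlgebra.reverse (A : Cl n) * (A : Cl n) = 1 := by
    have h := spinGroup.star_mul_self_of_mem A.2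
    rwa [CliffordAlgebra.star_def, spinGroup.involute_eq A.2] at h
  rw [spinorForm_act, ← act_mul, h1, act_one]

/-- The vectors `u(ν₁, ..., ν_m) = u(ν₁) ⊗ ... ⊗ u(ν_m)` where `u(ν) = (1, -i ν) / √2`. -/
def uVec {n : ℕ} (ν : Fin (n / 2) → ℤˣ) : Spinor n :=
  WithLp.toLp 2 fun p : SpinIndex n =>
    ∏ k, ((1 / Real.sqrt 2 : ℝ) : ℂ) * ![1, -Complex.I * ((ν k : ℤ) : ℂ)] (p k)

/-- The positive (`ε = 1`) and negative (`ε = -1`) half spinors, for even `n`. -/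
def halfSpinor (n : ℕ) (ε : ℤˣ) : Submodule ℂ (Spinor n) :=
  Submodule.span ℂ {φ | ∃ ν : Fin (n / 2) → ℤˣ, ∏ k, ν k = ε ∧ φ = uVec ν}

theorem gammaFactor_mulVec (a k : ℕ) (ν : ℤˣ) : ∃ c : ℂ, ∀ p : Fin 2,
    (∑ q, gammaFactor a k p q * ![1, -Complex.I * ((ν : ℤ) : ℂ)] q)
      = c * ![1, -Complex.I * (((if k = a / 2 then -ν else ν : ℤˣ) : ℤ) : ℂ)] p := by
  have hν : ((ν : ℤ) : ℂ) * ((ν : ℤ) : ℂ) = 1 := by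
    rcases Int.units_eq_one_or ν with h | h <;> simp [h]
  unfold gammaFactor
  split_ifs
  · omega
  · refine ⟨-((ν : ℤ) : ℂ), fun p => ?_⟩
    fin_cases p
    · simp only [matT, Fin.sum_univ_two]
      simp
      linear_combination ((ν : ℤ) : ℂ) * Complex.I_mul_I
    · simp only [matT, Fin.sum_univ_two]
      simp
      linear_combination (-Complex.I) * hν
  · refine ⟨Complex.I, fun p => ?_⟩
    fin_cases p <;> simp [matG1, Fin.sum_univ_two]
  · refine ⟨((ν : ℤ) : ℂ), fun p => ?_⟩
    fin_cases p
    · simp only [matG2, Fin.sum_univ_two]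
      simp
      linear_combination (-((ν : ℤ) : ℂ)) * Complex.I_mul_I
    · simp only [matG2, Fin.sum_univ_two]
      simp
      linear_combination (-Complex.I) * hν
  · refine ⟨1, fun p => ?_⟩
    simp [Matrix.one_apply]

theorem gamma_uVec {n : ℕ} (a : Fin n) (ν : Fin (n / 2) → ℤˣ) : ∃ c : ℂ,
    Matrix.toEuclideanCLM (𝕜 := ℂ) (gamma a) (uVec ν)
      = c • uVec fun k => if (k : ℕ) = (a : ℕ) / 2 then -ν k else ν k := by
  choose c hc using fun k : Fin (n / 2) => gammaFactor_mulVec a k (ν k)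
  refine ⟨gammaScalar n a * ∏ k, c k, ?_⟩
  ext p
  have h1 : (Matrix.toEuclideanCLM (𝕜 := ℂ) (gamma a) (uVec ν)) p
      = gammaScalar n a * ∑ q : SpinIndex n, ∏ k : Fin (n / 2), (((1 / Real.sqrt 2 : ℝ) : ℂ) *
        (gammaFactor a k (p k) (q k) * ![1, -Complex.I * ((ν k : ℤ) : ℂ)] (q k))) := by
    rw [Matrix.ofLp_toEuclideanCLM]
    simp only [gamma, uVec, kron, Matrix.mulVec, dotProduct, Matrix.smul_apply, Matrix.of_apply,
      smul_eq_mul, Finset.mul_sum]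
    refine Finset.sum_congr rfl fun q _ => ?_
    rw [mul_assoc, ← Finset.prod_mul_distrib]
    congr 1
    exact Finset.prod_congr rfl fun k _ => by ring
  rw [h1]
  have h2 := Finset.prod_univ_sum (fun _ : Fin (n / 2) => (Finset.univ : Finset (Fin 2)))
    (fun k q => ((1 / Real.sqrt 2 : ℝ) : ℂ) *
        (gammaFactor a k (p k) q * ![1, -Complex.I * ((ν k : ℤ) : ℂ)] q))
  rw [Fintype.piFinset_univ] at h2
  rw [← h2]
  simp only [← Finset.mul_sum, hc]
  simp only [uVec, PiLp.smul_apply, smul_eq_mul, mul_assoc, ← Finset.prod_mul_distrib]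
  congr 1
  exact Finset.prod_congr rfl fun k _ => by ring

theorem act_ι_mem_halfSpinor {n : ℕ} (hn : Even n) {ε : ℤˣ} (v : Fin n → ℝ) {φ : Spinor n}
    (hφ : φ ∈ halfSpinor n ε) :
    act (CliffordAlgebra.ι (cliffordForm n) v) φ ∈ halfSpinor n (-ε) := by
  induction hφ using Submodule.span_induction with
  | mem φ h =>
    obtain ⟨ν, hν, rfl⟩ := h
    rw [act_ι]
    refine Submodule.sum_mem _ fun a _ => Submodule.smul_mem _ _ ?_
    obtain ⟨c, hc⟩ := gamma_uVec a ν
    rw [hc]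
    refine Submodule.smul_mem _ _ (Submodule.subset_span ⟨_, ?_, rfl⟩)
    have ha : (a : ℕ) / 2 < n / 2 := by
      have := a.2
      obtain ⟨m, rfl⟩ := hn
      omega
    rw [← hν]
    have h3 : ∀ k : Fin (n / 2), (if (k : ℕ) = (a : ℕ) / 2 then -ν k else ν k)
        = (if k = (⟨a / 2, ha⟩ : Fin (n / 2)) then -1 else 1) * ν k := by
      intro k
      simp only [Fin.ext_iff]
      split_ifs <;> simp
    simp only [h3, Finset.prod_mul_distrib, Finset.prod_ite_eq', Finset.mem_univ, if_true]
    simp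
  | zero => simp
  | add φ ψ _ _ h1 h2 => rw [map_add]; exact Submodule.add_mem _ h1 h2
  | smul c φ _ h => rw [map_smul]; exact Submodule.smul_mem _ _ h

/-- For even `n` the spin group preserves the half spinors. -/
theorem act_spin_mem_halfSpinor {n : ℕ} (hn : Even n) {ε : ℤˣ} (A : Spin n) {φ : Spinor n}
    (hφ : φ ∈ halfSpinor n ε) : act (A : Cl n) φ ∈ halfSpinor n ε := by
  have key : ∀ B : Cl n, B ∈ CliffordAlgebra.evenOdd (cliffordForm n) 0 →
      act B φ ∈ halfSpinor n ε := by
    intro B hB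
    induction B, hB using CliffordAlgebra.even_induction with
    | algebraMap r =>
      have h : act (algebraMap ℝ (Cl n) r) φ = (r : ℂ) • φ := act_algebraMap r φ
      rw [h]
      exact Submodule.smul_mem _ _ hφ
    | add _ _ _ _ h1 h2 =>
      rw [act_add]
      exact Submodule.add_mem _ h1 h2
    | ι_mul_ι_mul v w _ _ h =>
      rw [act_mul, act_mul]
      simpa using act_ι_mem_halfSpinor hn v (act_ι_mem_halfSpinor hn w h)
  exact key _ (spinGroup.mem_even A.2)

/-! ### Lorentzian manifolds and spin structures -/

variable {n : ℕ}

/-- A smooth Lorentzian metric of signature `(-, +, ..., +)` on an `n`-dimensional manifold. -/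
structure LorentzianMetric (n : ℕ) (M : Type*) [TopologicalSpace M]
    [ChartedSpace (EuclideanSpace ℝ (Fin n)) M] [IsManifold (𝓡 n) ∞ M] where
  val (x : M) : TangentSpace (𝓡 n) x →L[ℝ] TangentSpace (𝓡 n) x →L[ℝ] ℝ
  symm (x : M) (X Y : TangentSpace (𝓡 n) x) : val x X Y = val x Y X
  signature (x : M) : ∃ e : Module.Basis (Fin n) ℝ (TangentSpace (𝓡 n) x),
    ∀ a b, val x (e a) (e b) = if a = b then eta a else 0
  contMDiff : ContMDiff (𝓡 n)
    ((𝓡 n).prod 𝓘(ℝ, EuclideanSpace ℝ (Fin n) →L[ℝ] EuclideanSpace ℝ (Fin n) →L[ℝ] ℝ)) ∞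
    (fun x => Bundle.TotalSpace.mk'
      (EuclideanSpace ℝ (Fin n) →L[ℝ] EuclideanSpace ℝ (Fin n) →L[ℝ] ℝ) x (val x))

/-- A spin structure on an oriented and time-oriented Lorentzian manifold, in terms of local
sections: a cover by open sets `baseSet i` with smooth orthonormal frames on them (the positively
oriented, future-directed ones) and a cocycle of smooth functions `lift i j` on the overlaps with
values in the spin group that covers the change of frames: if `X` has the coordinates `X_i` in the
frame `i`, then `X_i = A X_j A⁻¹` with `A = lift i j`. Since the spin group covers `SO₀(1, n-1)`,
the frames determine the orientation and the time-orientation. The values of `frame i` off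
`baseSet i` and of `lift i j` off the overlap play no role. Smoothness of `lift` is stated through
its (faithful) action on spinors. -/
structure SpinStructure {M : Type*} [TopologicalSpace M]
    [ChartedSpace (EuclideanSpace ℝ (Fin n)) M] [IsManifold (𝓡 n) ∞ M]
    (g : LorentzianMetric n M) (ι : Type*) where
  baseSet : ι → Set M
  isOpen_baseSet : ∀ i, IsOpen (baseSet i)
  indexAt : M → ι
  mem_baseSet_at : ∀ x, x ∈ baseSet (indexAt x)
  frame : ι → (x : M) → Module.Basis (Fin n) ℝ (TangentSpace (𝓡 n) x)
  orthonormal : ∀ i, ∀ x ∈ baseSet i, ∀ a b,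
    g.val x (frame i x a) (frame i x b) = if a = b then eta a else 0
  contMDiffOn_frame : ∀ i a, ContMDiffOn (𝓡 n) ((𝓡 n).prod 𝓘(ℝ, EuclideanSpace ℝ (Fin n))) ∞
    (fun x => Bundle.TotalSpace.mk' (EuclideanSpace ℝ (Fin n)) x (frame i x a)) (baseSet i)
  lift : ι → ι → M → Spin n
  lift_comp : ∀ i j k, ∀ x ∈ baseSet i ∩ baseSet j ∩ baseSet k,
    lift k j x * lift j i x = lift k i x
  lift_frame : ∀ i j, ∀ x ∈ baseSet i ∩ baseSet j, ∀ X : TangentSpace (𝓡 n) x,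
    CliffordAlgebra.ι (cliffordForm n) ((frame i x).equivFun X) * (lift i j x : Cl n)
      = (lift i j x : Cl n) * CliffordAlgebra.ι (cliffordForm n) ((frame j x).equivFun X)
  contMDiffOn_lift : ∀ i j, ContMDiffOn (𝓡 n) 𝓘(ℝ, Spinor n →L[ℝ] Spinor n) ∞
    (fun x => (act (lift i j x : Cl n)).restrictScalars ℝ) (baseSet i ∩ baseSet j)

namespace SpinStructure

variable {M : Type*} [TopologicalSpace M] [ChartedSpace (EuclideanSpace ℝ (Fin n)) M]
  [IsManifold (𝓡 n) ∞ M] {g : LorentzianMetric n M} {ι : Type*} (S : SpinStructure g ι)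

theorem lift_self (i : ι) (x : M) (hx : x ∈ S.baseSet i) : S.lift i i x = 1 := by
  have h := S.lift_comp i i i x ⟨⟨hx, hx⟩, hx⟩
  exact mul_eq_left.mp h

/-- The spinor bundle: the vector bundle associated to the spin structure by the spin
representation. The coordinates `φ_i` of a spinor satisfy `φ_j = lift j i · φ_i`. -/
def core : VectorBundleCore ℝ M (Spinor n) ι where
  baseSet := S.baseSet
  isOpen_baseSet := S.isOpen_baseSet
  indexAt := S.indexAt
  mem_baseSet_at := S.mem_baseSet_at
  coordChange i j x := (act (S.lift j i x : Cl n)).restrictScalars ℝ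
  coordChange_self i x hx v := by
    rw [S.lift_self i x hx]
    exact act_one v
  continuousOn_coordChange i j := by
    have h := (S.contMDiffOn_lift j i).continuousOn
    rwa [Set.inter_comm] at h
  coordChange_comp i j k x hx v := by
    have h := S.lift_comp i j k x hx
    simp only [ContinuousLinearMap.coe_restrictScalars']
    rw [← act_mul, ← h]
    rfl

instance core_isContMDiff : S.core.IsContMDiff (𝓡 n) ∞ where
  contMDiffOn_coordChange i j := by
    have h := S.contMDiffOn_lift j i
    rw [Set.inter_comm] at h
    exact h

/-- The fiber `S_x` of the spinor bundle, identified with the spinor module by means of the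
trivialization with index `indexAt x`. -/
abbrev Fiber (x : M) : Type := S.core.Fiber x

/-- A spinor at `x`, written in the trivialization with index `indexAt x`. -/
def coord {x : M} (φ : S.Fiber x) : Spinor n := φ

/-- The fibers of the spinor bundle are complex vector spaces. -/
instance (x : M) : Module ℂ (S.Fiber x) := inferInstanceAs (Module ℂ (Spinor n))

/-- Clifford multiplication `X · φ` of a tangent vector and a spinor. -/
def cliff {x : M} (X : TangentSpace (𝓡 n) x) (φ : S.Fiber x) : S.Fiber x :=
  act (CliffordAlgebra.ι (cliffordForm n) ((S.frame (S.indexAt x) x).equivFun X)) (S.coord φ)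

/-- The inner product of the spinor bundle. -/
def form [NeZero n] {x : M} (φ ψ : S.Fiber x) : ℂ := spinorForm (S.coord φ) (S.coord ψ)

/-- The fiber of the half spinor bundle `S^+` (`ε = 1`) or `S^-` (`ε = -1`), for even `n`. -/
def half (ε : ℤˣ) (x : M) : Submodule ℂ (S.Fiber x) := halfSpinor n ε

/-- The Dirac current `V_φ = -∑ η_a ⟨e_a · φ, φ⟩ e_a`, with an orthonormal frame `e`. It is
characterized by `g (V_φ, X) = -⟨X · φ, φ⟩`, see `val_diracCurrent` and `eq_diracCurrent`. -/
def diracCurrent [NeZero n] {x : M} (φ : S.Fiber x) : TangentSpace (𝓡 n) x :=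
  ∑ a, (-eta a * (S.form (S.cliff (S.frame (S.indexAt x) x a) φ) φ).re) •
    S.frame (S.indexAt x) x a

/-- In every trivialization, Clifford multiplication is given by the coordinates with respect to
the corresponding frame. -/
theorem coordChange_cliff (i : ι) {x : M} (hx : x ∈ S.baseSet i) (X : TangentSpace (𝓡 n) x)
    (φ : S.Fiber x) :
    S.core.coordChange (S.indexAt x) i x (S.coord (S.cliff X φ))
      = act (CliffordAlgebra.ι (cliffordForm n) ((S.frame i x).equivFun X))
          (S.core.coordChange (S.indexAt x) i x (S.coord φ)) := by
  have h := S.lift_frame i (S.indexAt x) x ⟨hx, S.mem_baseSet_at x⟩ X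
  change act _ (act _ _) = act _ (act _ _)
  rw [← act_mul, ← act_mul, h]

/-- In every trivialization, the inner product is the indefinite inner product of spinors. -/
theorem form_coordChange [NeZero n] (i : ι) {x : M} (φ ψ : S.Fiber x) :
    spinorForm (S.core.coordChange (S.indexAt x) i x (S.coord φ))
      (S.core.coordChange (S.indexAt x) i x (S.coord ψ)) = S.form φ ψ :=
  spinorForm_spin _ _ _

/-- The half spinor bundles do not depend on the trivialization. -/
theorem coordChange_mem_half (hn : Even n) (i : ι) {x : M} {ε : ℤˣ} {φ : S.Fiber x}
    (hφ : φ ∈ S.half ε x) :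
    S.core.coordChange (S.indexAt x) i x (S.coord φ) ∈ halfSpinor n ε :=
  act_spin_mem_halfSpinor hn _ hφ

theorem form_cliff [NeZero n] {x : M} (X : TangentSpace (𝓡 n) x) (φ ψ : S.Fiber x) :
    S.form (S.cliff X φ) ψ = S.form φ (S.cliff X ψ) :=
  spinorForm_act_ι _ _ _

theorem form_cliff_sum [NeZero n] {x : M} (X : TangentSpace (𝓡 n) x) (φ : S.Fiber x) :
    S.form (S.cliff X φ) φ
      = ∑ a, (((S.frame (S.indexAt x) x).equivFun X a : ℝ) : ℂ) *
          S.form (S.cliff (S.frame (S.indexAt x) x a) φ) φ := by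
  have h : ∀ Y : TangentSpace (𝓡 n) x, S.form (S.cliff Y φ) φ
      = ∑ a, (((S.frame (S.indexAt x) x).equivFun Y a : ℝ) : ℂ) *
        spinorForm (Matrix.toEuclideanCLM (𝕜 := ℂ) (gamma a) (S.coord φ)) (S.coord φ) := by
    intro Y
    rw [← spinorForm_sum_smul_left, ← act_ι]
    rfl
  rw [h]
  refine Finset.sum_congr rfl fun a _ => ?_
  rw [h]
  congr 1
  rw [Finset.sum_eq_single a] <;> simp +contextual [eq_comm]

/-- The defining property of the Dirac current. -/
theorem val_diracCurrent [NeZero n] {x : M} (φ : S.Fiber x) (X : TangentSpace (𝓡 n) x) :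
    ((g.val x (S.diracCurrent φ) X : ℝ) : ℂ) = -S.form (S.cliff X φ) φ := by
  have hre : ∀ Y : TangentSpace (𝓡 n) x,
      (((S.form (S.cliff Y φ) φ).re : ℝ) : ℂ) = S.form (S.cliff Y φ) φ := by
    intro Y
    rw [← Complex.conj_eq_iff_re]
    conv_rhs => rw [form_cliff]
    exact spinorForm_conj _ _
  have hbasis : ∀ b, g.val x (S.diracCurrent φ) (S.frame (S.indexAt x) x b)
      = -(S.form (S.cliff (S.frame (S.indexAt x) x b) φ) φ).re := by
    intro b
    have ho := S.orthonormal (S.indexAt x) x (S.mem_baseSet_at x)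
    simp only [diracCurrent, map_sum, map_smul, sum_apply,
      smul_apply, ho, smul_eq_mul, mul_ite, mul_zero, Finset.sum_ite_eq',
      Finset.mem_univ, if_true]
    have : eta b * eta b = 1 := by unfold eta; split_ifs <;> norm_num
    linear_combination (-(S.form (S.cliff (S.frame (S.indexAt x) x b) φ) φ).re) * this
  rw [form_cliff_sum]
  conv_lhs => rw [← (S.frame (S.indexAt x) x).sum_equivFun X]
  simp only [map_sum, map_smul, hbasis, smul_eq_mul, Complex.ofReal_sum, Complex.ofReal_mul,
    Complex.ofReal_neg, hre, mul_neg, Finset.sum_neg_distrib]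

/-- The Dirac current is determined by its defining property. -/
theorem eq_diracCurrent [NeZero n] {x : M} (φ : S.Fiber x) (V : TangentSpace (𝓡 n) x)
    (hV : ∀ X, ((g.val x V X : ℝ) : ℂ) = -S.form (S.cliff X φ) φ) : V = S.diracCurrent φ := by
  have h : ∀ X, g.val x (V - S.diracCurrent φ) X = 0 := by
    intro X
    have h1 := (hV X).trans (S.val_diracCurrent φ X).symm
    rw [map_sub, sub_apply, Complex.ofReal_injective h1, sub_self]
  rw [← sub_eq_zero]
  obtain ⟨e, he⟩ := g.signature x
  refine e.ext_elem_iff.mpr fun b => ?_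
  have hb := h (e b)
  rw [← e.sum_repr (V - S.diracCurrent φ)] at hb
  simp only [map_sum, map_smul, sum_apply, smul_apply, he,
    smul_eq_mul, mul_ite, mul_zero, Finset.sum_ite_eq', Finset.mem_univ, if_true] at hb
  have : eta b ≠ 0 := by unfold eta; split_ifs <;> norm_num
  simpa [this] using hb

/-- A smooth, fiberwise antilinear bundle map of the spinor bundle to itself, over the identity. -/
structure AntilinearMap where
  toFun (x : M) : S.Fiber x →ₛₗ[starRingEnd ℂ] S.Fiber x
  contMDiff : ContMDiff ((𝓡 n).prod 𝓘(ℝ, Spinor n)) ((𝓡 n).prod 𝓘(ℝ, Spinor n)) ∞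
    (fun p : Bundle.TotalSpace (Spinor n) S.core.Fiber =>
      Bundle.TotalSpace.mk' (Spinor n) p.proj (toFun p.proj p.2))

/-- A real structure on the spinor bundle: a smooth antilinear bundle map with square `1`. -/
structure RealStructure extends S.AntilinearMap where
  sq (x : M) (φ : S.Fiber x) : toFun x (toFun x φ) = φ

/-- A quaternionic structure on the spinor bundle: a smooth antilinear bundle map with
square `-1`. -/
structure QuaternionicStructure extends S.AntilinearMap where
  sq (x : M) (φ : S.Fiber x) : toFun x (toFun x φ) = -φ

end SpinStructure

end LorentzSpin

end

/-! Everything reduces to identities in the spinor module. Setting `X = V_φ` in the defining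
property of the Dirac current gives `g(V_φ, V_φ) = -⟨V_φ · φ, φ⟩`, so the norm formulas follow once
`V_φ · φ` is known, and `V_φ` is lightlike when `V_φ · φ = 0`. Moreover `⟨e₀ · φ, φ⟩ = |φ|²`, so a
nonzero spinor of any dimension has a nonzero current.

The formulas for `V_φ · φ` are Fierz identities, cubic in the components of `φ` and their
conjugates. Each basis vector acts by flipping some bits of the index and multiplying by a fourth
root of unity (`cliffBasis_two` to `cliffBasis_seven`), so each identity is a finite polynomial
check (`currentAct_two` to `currentAct_seven`). In even dimension, half spinors are eigenvectors of
`T ⊗ ... ⊗ T` (`sum_matT_mul_of_mem_halfSpinor`); this expresses half of the components by the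
others, and the cubic then vanishes.

The real and quaternionic structures are complex conjugation followed by the product of all `e_a`
with imaginary matrix: `e₁` for `n = 3`, `e₁e₄` for `n = 5`, `e₁e₄e₅` for `n = 7`. Such a map
commutes or anticommutes with all vectors at once, hence commutes with the spin group
(`antilinear_act_spin`), and so defines a smooth map of the bundle (`constAntilinearMap`). For `n =
3`, a spinor fixed by `τ` has `⟨φ, φ⟩ = -⟨φ, φ⟩ = 0`, which makes its current lightlike. -/

noncomputable section

namespace LorentzSpin

/-! ### Clifford multiplication in components -/

/-- Clifford multiplication by the basis vector `e_a`. -/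
abbrev cliffBasis {n : ℕ} (a : Fin n) : Spinor n →L[ℂ] Spinor n :=
  Matrix.toEuclideanCLM (𝕜 := ℂ) (gamma a)

theorem cliffBasis_apply {n : ℕ} (a : Fin n) (φ : Spinor n) (p : SpinIndex n) :
    cliffBasis a φ p = gammaScalar n a *
      ∑ q : SpinIndex n, (∏ k : Fin (n / 2), gammaFactor a k (p k) (q k)) * φ q := by
  rw [cliffBasis, Matrix.ofLp_toEuclideanCLM]
  simp [gamma, kron, Matrix.mulVec, dotProduct, Finset.mul_sum, mul_assoc]

theorem sum_fin_one_arrow {α : Type*} [AddCommMonoid α] (f : (Fin 1 → Fin 2) → α) :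
    ∑ q, f q = ∑ i, f ![i] :=
  Fintype.sum_equiv (Equiv.funUnique (Fin 1) (Fin 2)) _ _ fun q => by
    congr 1; ext k; fin_cases k; rfl

theorem sum_fin_two_arrow {α : Type*} [AddCommMonoid α] (f : (Fin 2 → Fin 2) → α) :
    ∑ q, f q = ∑ i, ∑ j, f ![i, j] := by
  rw [← (finTwoArrowEquiv (Fin 2)).symm.sum_comp, Fintype.sum_prod_type]
  rfl

theorem sum_fin_three_arrow {α : Type*} [AddCommMonoid α] (f : (Fin 3 → Fin 2) → α) :
    ∑ q, f q = ∑ i, ∑ j, ∑ k, f ![i, j, k] := by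
  rw [← (Fin.consEquiv fun _ : Fin 3 => Fin 2).sum_comp, Fintype.sum_prod_type]
  refine Finset.sum_congr rfl fun i _ => ?_
  rw [sum_fin_two_arrow]
  rfl

theorem spinorForm_eq_sum {n : ℕ} [NeZero n] (φ ψ : Spinor n) :
    spinorForm φ ψ = ∑ p, cliffBasis 0 φ p * (starRingEnd ℂ) (ψ p) := by
  simp [spinorForm, PiLp.inner_apply]

theorem I_mul_I_mul (z : ℂ) : Complex.I * (Complex.I * z) = -z := by
  rw [← mul_assoc, Complex.I_mul_I, neg_one_mul]

/-- The sign `(-1) ^ i`. -/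
def bitSign (i : Fin 2) : ℂ := ![1, -1] i

@[simp] theorem bitSign_zero : bitSign 0 = 1 := rfl

@[simp] theorem bitSign_one : bitSign 1 = -1 := rfl

theorem cliffBasis_apply_two (a : Fin 2) (φ : Spinor 2) (i : Fin 2) :
    cliffBasis a φ ![i] = gammaScalar 2 a * ∑ x,
      gammaFactor a 0 i x * φ ![x] := by
  rw [cliffBasis_apply]
  refine congrArg _ ((sum_fin_one_arrow _).trans ?_)
  refine Finset.sum_congr rfl fun x _ => congrArg (· * _) ?_
  exact Fin.prod_univ_one _

/-- `T` and `g₂` are antidiagonal, `g₁` is diagonal, so `e_a` sends one basis vector to a multiple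
of one other. In `Fin 2`, `1 - i` is the flipped bit. The first entry of `![...]` belongs to the
rightmost tensor factor. -/
theorem cliffBasis_two (φ : Spinor 2) (i : Fin 2) :
    cliffBasis (n := 2) 0 φ ![i] = -(bitSign i * φ ![i]) ∧
    cliffBasis (n := 2) 1 φ ![i] = Complex.I * φ ![1 - i] := by
  simp only [cliffBasis_apply_two]
  revert i
  simp [Fin.forall_fin_two, gammaScalar, gammaFactor, matG1, matG2,
    Fin.sum_univ_two, I_mul_I_mul]

theorem cliffBasis_apply_three (a : Fin 3) (φ : Spinor 3) (i : Fin 2) :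
    cliffBasis a φ ![i] = gammaScalar 3 a * ∑ x,
      gammaFactor a 0 i x * φ ![x] := by
  rw [cliffBasis_apply]
  refine congrArg _ ((sum_fin_one_arrow _).trans ?_)
  refine Finset.sum_congr rfl fun x _ => congrArg (· * _) ?_
  exact Fin.prod_univ_one _

theorem cliffBasis_three (φ : Spinor 3) (i : Fin 2) :
    cliffBasis (n := 3) 0 φ ![i] = -(bitSign i * φ ![i]) ∧
    cliffBasis (n := 3) 1 φ ![i] = Complex.I * φ ![1 - i] ∧
    cliffBasis (n := 3) 2 φ ![i] = bitSign i * φ ![1 - i] := by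
  simp only [cliffBasis_apply_three]
  revert i
  simp [Fin.forall_fin_two, gammaScalar, gammaFactor, matT, matG1, matG2,
    Fin.sum_univ_two, I_mul_I_mul]

theorem cliffBasis_apply_four (a : Fin 4) (φ : Spinor 4) (i j : Fin 2) :
    cliffBasis a φ ![i, j] = gammaScalar 4 a * ∑ x, ∑ y,
      gammaFactor a 0 i x * gammaFactor a 1 j y * φ ![x, y] := by
  rw [cliffBasis_apply]
  refine congrArg _ ((sum_fin_two_arrow _).trans ?_)
  refine Finset.sum_congr rfl fun x _ => Finset.sum_congr rfl fun y _ => congrArg (· * _) ?_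
  exact Fin.prod_univ_two _

theorem cliffBasis_four (φ : Spinor 4) (i j : Fin 2) :
    cliffBasis (n := 4) 0 φ ![i, j] = -(bitSign i * φ ![i, j]) ∧
    cliffBasis (n := 4) 1 φ ![i, j] = Complex.I * φ ![1 - i, j] ∧
    cliffBasis (n := 4) 2 φ ![i, j] = bitSign i * bitSign j * φ ![1 - i, j] ∧
    cliffBasis (n := 4) 3 φ ![i, j] = bitSign i * φ ![1 - i, 1 - j] := by
  simp only [cliffBasis_apply_four]
  revert i j
  simp [Fin.forall_fin_two, gammaScalar, gammaFactor, matT, matG1, matG2, Matrix.one_fin_two,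
    Fin.sum_univ_two, mul_assoc, I_mul_I_mul]

theorem cliffBasis_apply_five (a : Fin 5) (φ : Spinor 5) (i j : Fin 2) :
    cliffBasis a φ ![i, j] = gammaScalar 5 a * ∑ x, ∑ y,
      gammaFactor a 0 i x * gammaFactor a 1 j y * φ ![x, y] := by
  rw [cliffBasis_apply]
  refine congrArg _ ((sum_fin_two_arrow _).trans ?_)
  refine Finset.sum_congr rfl fun x _ => Finset.sum_congr rfl fun y _ => congrArg (· * _) ?_
  exact Fin.prod_univ_two _

theorem cliffBasis_five (φ : Spinor 5) (i j : Fin 2) :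
    cliffBasis (n := 5) 0 φ ![i, j] = -(bitSign i * φ ![i, j]) ∧
    cliffBasis (n := 5) 1 φ ![i, j] = Complex.I * φ ![1 - i, j] ∧
    cliffBasis (n := 5) 2 φ ![i, j] = bitSign i * bitSign j * φ ![1 - i, j] ∧
    cliffBasis (n := 5) 3 φ ![i, j] = bitSign i * φ ![1 - i, 1 - j] ∧
    cliffBasis (n := 5) 4 φ ![i, j] =
      -Complex.I * bitSign i * bitSign j * φ ![1 - i, 1 - j] := by
  simp only [cliffBasis_apply_five]
  revert i j
  simp [Fin.forall_fin_two, gammaScalar, gammaFactor, matT, matG1, matG2, Matrix.one_fin_two,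
    Fin.sum_univ_two, mul_assoc, I_mul_I_mul]

theorem cliffBasis_apply_six (a : Fin 6) (φ : Spinor 6) (i j k : Fin 2) :
    cliffBasis a φ ![i, j, k] = gammaScalar 6 a * ∑ x, ∑ y, ∑ z,
      gammaFactor a 0 i x * gammaFactor a 1 j y * gammaFactor a 2 k z * φ ![x, y, z] := by
  rw [cliffBasis_apply]
  refine congrArg _ ((sum_fin_three_arrow _).trans ?_)
  refine Finset.sum_congr rfl fun x _ => Finset.sum_congr rfl fun y _ =>
    Finset.sum_congr rfl fun z _ => congrArg (· * _) ?_
  exact Fin.prod_univ_three _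

theorem cliffBasis_six (φ : Spinor 6) (i j k : Fin 2) :
    cliffBasis (n := 6) 0 φ ![i, j, k] = -(bitSign i * φ ![i, j, k]) ∧
    cliffBasis (n := 6) 1 φ ![i, j, k] = Complex.I * φ ![1 - i, j, k] ∧
    cliffBasis (n := 6) 2 φ ![i, j, k] = bitSign i * bitSign j * φ ![1 - i, j, k] ∧
    cliffBasis (n := 6) 3 φ ![i, j, k] = bitSign i * φ ![1 - i, 1 - j, k] ∧
    cliffBasis (n := 6) 4 φ ![i, j, k] =
      -Complex.I * bitSign i * bitSign j * bitSign k * φ ![1 - i, 1 - j, k] ∧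
    cliffBasis (n := 6) 5 φ ![i, j, k] =
      -Complex.I * bitSign i * bitSign j * φ ![1 - i, 1 - j, 1 - k] := by
  simp only [cliffBasis_apply_six]
  revert i j k
  simp [Fin.forall_fin_two, gammaScalar, gammaFactor, matT, matG1, matG2, Matrix.one_fin_two,
    Fin.sum_univ_two, mul_assoc, I_mul_I_mul]

theorem cliffBasis_apply_seven (a : Fin 7) (φ : Spinor 7) (i j k : Fin 2) :
    cliffBasis a φ ![i, j, k] = gammaScalar 7 a * ∑ x, ∑ y, ∑ z,
      gammaFactor a 0 i x * gammaFactor a 1 j y * gammaFactor a 2 k z * φ ![x, y, z] := by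
  rw [cliffBasis_apply]
  refine congrArg _ ((sum_fin_three_arrow _).trans ?_)
  refine Finset.sum_congr rfl fun x _ => Finset.sum_congr rfl fun y _ =>
    Finset.sum_congr rfl fun z _ => congrArg (· * _) ?_
  exact Fin.prod_univ_three _

theorem cliffBasis_seven (φ : Spinor 7) (i j k : Fin 2) :
    cliffBasis (n := 7) 0 φ ![i, j, k] = -(bitSign i * φ ![i, j, k]) ∧
    cliffBasis (n := 7) 1 φ ![i, j, k] = Complex.I * φ ![1 - i, j, k] ∧
    cliffBasis (n := 7) 2 φ ![i, j, k] = bitSign i * bitSign j * φ ![1 - i, j, k] ∧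
    cliffBasis (n := 7) 3 φ ![i, j, k] = bitSign i * φ ![1 - i, 1 - j, k] ∧
    cliffBasis (n := 7) 4 φ ![i, j, k] =
      -Complex.I * bitSign i * bitSign j * bitSign k * φ ![1 - i, 1 - j, k] ∧
    cliffBasis (n := 7) 5 φ ![i, j, k] =
      -Complex.I * bitSign i * bitSign j * φ ![1 - i, 1 - j, 1 - k] ∧
    cliffBasis (n := 7) 6 φ ![i, j, k] =
      -(bitSign i * bitSign j * bitSign k * φ ![1 - i, 1 - j, 1 - k]) := by
  simp only [cliffBasis_apply_seven]
  revert i j k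
  simp [Fin.forall_fin_two, gammaScalar, gammaFactor, matT, matG1, matG2, Matrix.one_fin_two,
    Fin.sum_univ_two, mul_assoc, I_mul_I_mul]

theorem forall_fin_one_arrow {P : (Fin 1 → Fin 2) → Prop} (h : ∀ i, P ![i]) (p) : P p := by
  convert h (p 0); ext k; fin_cases k; rfl

theorem forall_fin_two_arrow {P : (Fin 2 → Fin 2) → Prop} (h : ∀ i j, P ![i, j]) (p) : P p := by
  convert h (p 0) (p 1); ext k; fin_cases k <;> rfl

theorem forall_fin_three_arrow {P : (Fin 3 → Fin 2) → Prop} (h : ∀ i j k, P ![i, j, k]) (p) :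
    P p := by
  convert h (p 0) (p 1) (p 2); ext k; fin_cases k <;> rfl

/-- Complex conjugation of the components of a spinor. -/
def spinorConj {n : ℕ} : Spinor n →ₗ⋆[ℂ] Spinor n where
  toFun φ := WithLp.toLp 2 fun p => (starRingEnd ℂ) (φ p)
  map_add' φ ψ := by ext p; simp
  map_smul' c φ := by ext p; simp

@[simp] theorem spinorConj_apply {n : ℕ} (φ : Spinor n) (p : SpinIndex n) :
    spinorConj φ p = (starRingEnd ℂ) (φ p) := rfl

/-- The spinor `V_φ · φ`. -/
def currentAct {n : ℕ} [NeZero n] (φ : Spinor n) : Spinor n :=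
  ∑ a : Fin n, (((-eta a : ℝ) : ℂ) * spinorForm (cliffBasis a φ) φ) • cliffBasis a φ

theorem I_pow_six : Complex.I ^ 6 = -1 := by
  rw [Complex.I_pow_eq_pow_mod]; simp

/-- Half spinors are eigenvectors of `T ⊗ ... ⊗ T`. -/
theorem sum_matT_mul_of_mem_halfSpinor {n : ℕ} {ε : ℤˣ} {φ : Spinor n} (hφ : φ ∈ halfSpinor n ε)
    (p : SpinIndex n) :
    ∑ q : SpinIndex n, (∏ k, matT (p k) (q k)) * φ q = (-1) ^ (n / 2) * ((ε : ℤ) : ℂ) * φ p := by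
  induction hφ using Submodule.span_induction with
  | mem φ h =>
    obtain ⟨ν, rfl, rfl⟩ := h
    -- `T u(ν) = -ν u(ν)`: each of the `n / 2` factors contributes a `-1`, whence the sign `(-1) ^
    -- (n / 2)`.
    have hT : ∀ k, ∑ x, matT (p k) x *
        (((1 / Real.sqrt 2 : ℝ) : ℂ) * ![1, -Complex.I * ((ν k : ℤ) : ℂ)] x)
        = -((ν k : ℤ) : ℂ) *
          (((1 / Real.sqrt 2 : ℝ) : ℂ) * ![1, -Complex.I * ((ν k : ℤ) : ℂ)] (p k)) := by
      intro k
      generalize p k = i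
      rcases Int.units_eq_one_or (ν k) with h | h <;> rw [h] <;> fin_cases i <;>
        simp [matT] <;> ring_nf <;> simp
    simp only [uVec, ← Finset.prod_mul_distrib]
    -- A Kronecker product acts factor by factor on a pure tensor: the sum over all indices of a
    -- product is the product of the sums.
    have h2 := Finset.prod_univ_sum (fun _ : Fin (n / 2) => (Finset.univ : Finset (Fin 2)))
      (fun k x => matT (p k) x *
        (((1 / Real.sqrt 2 : ℝ) : ℂ) * ![1, -Complex.I * ((ν k : ℤ) : ℂ)] x))
    rw [Fintype.piFinset_univ] at h2
    rw [← h2, Finset.prod_congr rfl fun k _ => hT k, Finset.prod_mul_distrib, Finset.prod_neg]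
    simp
  | zero => simp
  | add φ ψ _ _ h1 h2 =>
    simp only [PiLp.add_apply, mul_add, Finset.sum_add_distrib, h1, h2]
  | smul c φ _ h =>
    simp only [PiLp.smul_apply, smul_eq_mul, mul_left_comm _ c, ← Finset.mul_sum, h]

/-! ### The cubic identities for `V_φ · φ` in dimensions 2 to 7 -/

theorem ext_two {φ ψ : Spinor 2} (h : ∀ i, φ ![i] = ψ ![i]) : φ = ψ :=
  PiLp.ext (forall_fin_one_arrow (P := fun p => φ p = ψ p) h)

theorem spinorForm_two (φ ψ : Spinor 2) : spinorForm φ ψ =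
    ∑ i, cliffBasis (n := 2) 0 φ ![i] * (starRingEnd ℂ) (ψ ![i]) :=
  (spinorForm_eq_sum φ ψ).trans (sum_fin_one_arrow _)

/-- One row of the eigenvalue equation. Since `T` has zero diagonal, the row with index `i` involves
only the component at the flipped index. -/
theorem apply_one_sub_two {ε : ℤˣ} {φ : Spinor 2} (hφ : φ ∈ halfSpinor 2 ε) (i : Fin 2) :
    φ ![1 - i] = -Complex.I * ((ε : ℤ) : ℂ) * bitSign i * φ ![i] := by
  have h : ∑ x, matT i x * φ ![x] =
      (-1) ^ 1 * ((ε : ℤ) : ℂ) * φ ![i] := by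
    refine Eq.trans (Eq.symm ((sum_fin_one_arrow _).trans ?_))
      (sum_matT_mul_of_mem_halfSpinor hφ ![i])
    refine Finset.sum_congr rfl fun x _ => congrArg (· * _) ?_
    exact Fin.prod_univ_one _
  revert i
  rcases Int.units_eq_one_or ε with rfl | rfl
  all_goals
    simp [Fin.forall_fin_two, Fin.sum_univ_two, matT, mul_assoc]
    try grind [Complex.I_mul_I]

theorem currentAct_two {ε : ℤˣ} {φ : Spinor 2} (hφ : φ ∈ halfSpinor 2 ε) :
    currentAct φ = 0 := by
  -- Eliminates the component with bit 1; the claim becomes a polynomial identity in `φ ![0]` and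
  -- its conjugate.
  have h := apply_one_sub_two hφ 0
  simp only [sub_zero] at h
  refine ext_two fun i => ?_
  simp only [currentAct, Fin.sum_univ_two, spinorForm_two, PiLp.add_apply, PiLp.smul_apply,
    cliffBasis_two, Fin.sum_univ_two, eta]
  revert i
  simp only [Fin.forall_fin_two]
  rcases Int.units_eq_one_or ε with rfl | rfl
  all_goals
    simp [h]
    repeat' apply And.intro
  all_goals
    ring_nf
    simp only [Complex.I_sq, Complex.I_pow_three, Complex.I_pow_four]
    ring

theorem ext_three {φ ψ : Spinor 3} (h : ∀ i, φ ![i] = ψ ![i]) : φ = ψ :=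
  PiLp.ext (forall_fin_one_arrow (P := fun p => φ p = ψ p) h)

theorem spinorForm_three (φ ψ : Spinor 3) : spinorForm φ ψ =
    ∑ i, cliffBasis (n := 3) 0 φ ![i] * (starRingEnd ℂ) (ψ ![i]) :=
  (spinorForm_eq_sum φ ψ).trans (sum_fin_one_arrow _)

/-- No relation between the components is needed here: after expansion both sides are the same
polynomial in the components and their conjugates, modulo `I ^ 2 = -1`. -/
theorem currentAct_three (φ : Spinor 3) : currentAct φ = spinorForm φ φ • φ := by
  refine ext_three fun i => ?_

  simp only [currentAct, Fin.sum_univ_three, spinorForm_three, PiLp.add_apply, PiLp.smul_apply,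
    cliffBasis_three, Fin.sum_univ_two, eta]
  revert i
  simp only [Fin.forall_fin_two]
  simp
  repeat' apply And.intro
  all_goals
    ring_nf
    simp only [Complex.I_sq]
    ring

theorem ext_four {φ ψ : Spinor 4} (h : ∀ i j, φ ![i, j] = ψ ![i, j]) : φ = ψ :=
  PiLp.ext (forall_fin_two_arrow (P := fun p => φ p = ψ p) h)

theorem spinorForm_four (φ ψ : Spinor 4) : spinorForm φ ψ =
    ∑ i, ∑ j, cliffBasis (n := 4) 0 φ ![i, j] * (starRingEnd ℂ) (ψ ![i, j]) :=
  (spinorForm_eq_sum φ ψ).trans (sum_fin_two_arrow _)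

theorem apply_one_sub_four {ε : ℤˣ} {φ : Spinor 4} (hφ : φ ∈ halfSpinor 4 ε) (i j : Fin 2) :
    φ ![1 - i, 1 - j] = -((ε : ℤ) : ℂ) * bitSign i * bitSign j * φ ![i, j] := by
  have h : ∑ x, ∑ y, matT i x * matT j y * φ ![x, y] =
      (-1) ^ 2 * ((ε : ℤ) : ℂ) * φ ![i, j] := by
    refine Eq.trans (Eq.symm ((sum_fin_two_arrow _).trans ?_))
      (sum_matT_mul_of_mem_halfSpinor hφ ![i, j])
    refine Finset.sum_congr rfl fun x _ => Finset.sum_congr rfl fun y _ => congrArg (· * _) ?_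
    exact Fin.prod_univ_two _
  revert i j
  rcases Int.units_eq_one_or ε with rfl | rfl
  all_goals
    simp [Fin.forall_fin_two, Fin.sum_univ_two, matT, mul_assoc, I_mul_I_mul]
    try grind [Complex.I_mul_I]

theorem currentAct_four {ε : ℤˣ} {φ : Spinor 4} (hφ : φ ∈ halfSpinor 4 ε) :
    currentAct φ = 0 := by
  -- As `j` varies this covers every component whose first bit is 1, so only those with first bit 0
  -- remain free.
  have h j := apply_one_sub_four hφ 0 j
  simp only [Fin.forall_fin_two, sub_zero, sub_self] at h
  refine ext_four fun i j => ?_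
  simp only [currentAct, Fin.sum_univ_four, spinorForm_four, PiLp.add_apply, PiLp.smul_apply,
    cliffBasis_four, Fin.sum_univ_two, eta]
  revert i j
  simp only [Fin.forall_fin_two]
  rcases Int.units_eq_one_or ε with rfl | rfl
  all_goals
    simp [h]
    repeat' apply And.intro
  all_goals
    ring_nf
    simp only [Complex.I_sq]
    ring

theorem ext_five {φ ψ : Spinor 5} (h : ∀ i j, φ ![i, j] = ψ ![i, j]) : φ = ψ :=
  PiLp.ext (forall_fin_two_arrow (P := fun p => φ p = ψ p) h)

theorem spinorForm_five (φ ψ : Spinor 5) : spinorForm φ ψ =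
    ∑ i, ∑ j, cliffBasis (n := 5) 0 φ ![i, j] * (starRingEnd ℂ) (ψ ![i, j]) :=
  (spinorForm_eq_sum φ ψ).trans (sum_fin_two_arrow _)

theorem currentAct_five (φ : Spinor 5) : currentAct φ = spinorForm φ φ • φ := by
  refine ext_five fun i j => ?_

  simp only [currentAct, Fin.sum_univ_five, spinorForm_five, PiLp.add_apply, PiLp.smul_apply,
    cliffBasis_five, Fin.sum_univ_two, eta]
  revert i j
  simp only [Fin.forall_fin_two]
  simp
  repeat' apply And.intro
  all_goals
    ring_nf
    simp only [Complex.I_sq]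
    ring

theorem ext_six {φ ψ : Spinor 6} (h : ∀ i j k, φ ![i, j, k] = ψ ![i, j, k]) : φ = ψ :=
  PiLp.ext (forall_fin_three_arrow (P := fun p => φ p = ψ p) h)

theorem spinorForm_six (φ ψ : Spinor 6) : spinorForm φ ψ =
    ∑ i, ∑ j, ∑ k, cliffBasis (n := 6) 0 φ ![i, j, k] * (starRingEnd ℂ) (ψ ![i, j, k]) :=
  (spinorForm_eq_sum φ ψ).trans (sum_fin_three_arrow _)

theorem apply_one_sub_six {ε : ℤˣ} {φ : Spinor 6} (hφ : φ ∈ halfSpinor 6 ε) (i j k : Fin 2) :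
    φ ![1 - i, 1 - j, 1 - k] = Complex.I * ((ε : ℤ) : ℂ) * bitSign i * bitSign j * bitSign k *
      φ ![i, j, k] := by
  have h : ∑ x, ∑ y, ∑ z, matT i x * matT j y * matT k z * φ ![x, y, z] =
      (-1) ^ 3 * ((ε : ℤ) : ℂ) * φ ![i, j, k] := by
    refine Eq.trans (Eq.symm ((sum_fin_three_arrow _).trans ?_))
      (sum_matT_mul_of_mem_halfSpinor hφ ![i, j, k])
    refine Finset.sum_congr rfl fun x _ => Finset.sum_congr rfl fun y _ =>
      Finset.sum_congr rfl fun z _ => congrArg (· * _) ?_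
    exact Fin.prod_univ_three _
  revert i j k
  rcases Int.units_eq_one_or ε with rfl | rfl
  all_goals
    simp [Fin.forall_fin_two, Fin.sum_univ_two, matT, mul_assoc, I_mul_I_mul]
    try grind [Complex.I_mul_I]

theorem currentAct_six {ε : ℤˣ} {φ : Spinor 6} (hφ : φ ∈ halfSpinor 6 ε) :
    currentAct φ = 0 := by
  have h j k := apply_one_sub_six hφ 0 j k
  simp only [Fin.forall_fin_two, sub_zero, sub_self] at h
  refine ext_six fun i j k => ?_
  simp only [currentAct, Fin.sum_univ_six, spinorForm_six, PiLp.add_apply, PiLp.smul_apply,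
    cliffBasis_six, Fin.sum_univ_two, eta]
  revert i j k
  simp only [Fin.forall_fin_two]
  rcases Int.units_eq_one_or ε with rfl | rfl
  all_goals
    simp [h]
    repeat' apply And.intro
  all_goals
    ring_nf
    simp only [Complex.I_sq, Complex.I_pow_three, Complex.I_pow_four]
    ring

theorem ext_seven {φ ψ : Spinor 7} (h : ∀ i j k, φ ![i, j, k] = ψ ![i, j, k]) : φ = ψ :=
  PiLp.ext (forall_fin_three_arrow (P := fun p => φ p = ψ p) h)

theorem spinorForm_seven (φ ψ : Spinor 7) : spinorForm φ ψ =
    ∑ i, ∑ j, ∑ k, cliffBasis (n := 7) 0 φ ![i, j, k] * (starRingEnd ℂ) (ψ ![i, j, k]) :=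
  (spinorForm_eq_sum φ ψ).trans (sum_fin_three_arrow _)

/-- The triple product is `quaternionicStructureSeven φ` written out, so that `cliffBasis_seven`
evaluates it. The analogous second term is absent in dimension 5 because there `⟨φ, Jφ⟩ = ⟨J(Jφ),
Jφ⟩ = -⟨φ, Jφ⟩`; in dimension 7 the signs impose no such constraint. -/
theorem currentAct_seven (φ : Spinor 7) : currentAct φ = spinorForm φ φ • φ +
    spinorForm φ (cliffBasis (n := 7) 1 (cliffBasis (n := 7) 4 (cliffBasis (n := 7) 5 (spinorConj
      φ)))) •
      cliffBasis (n := 7) 1 (cliffBasis (n := 7) 4 (cliffBasis (n := 7) 5 (spinorConj φ))) := by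
  refine ext_seven fun i j k => ?_
  have hc (p : Fin 3 → Fin 2) : spinorConj φ p = (starRingEnd ℂ) (φ p) := rfl
  simp only [currentAct, Fin.sum_univ_seven, spinorForm_seven, PiLp.add_apply, PiLp.smul_apply,
    cliffBasis_seven, Fin.sum_univ_two, eta, hc]
  revert i j k
  simp only [Fin.forall_fin_two]
  simp
  repeat' apply And.intro
  all_goals
    ring_nf
    simp only [Complex.I_sq, I_pow_six]
    ring

/-! ### Antilinear structures on the spinor module -/

/-- The real structure of the spinor module in dimension `3`. -/
def realStructureThree : Spinor 3 →ₗ⋆[ℂ] Spinor 3 :=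
  (cliffBasis (n := 3) 1).toLinearMap ∘ₛₗ spinorConj

/-- The quaternionic structure of the spinor module in dimension `5`. -/
def quaternionicStructureFive : Spinor 5 →ₗ⋆[ℂ] Spinor 5 :=
  (cliffBasis (n := 5) 1 ∘L cliffBasis (n := 5) 4).toLinearMap ∘ₛₗ spinorConj

/-- The quaternionic structure of the spinor module in dimension `7`. -/
def quaternionicStructureSeven : Spinor 7 →ₗ⋆[ℂ] Spinor 7 :=
  (cliffBasis (n := 7) 1 ∘L cliffBasis (n := 7) 4 ∘L cliffBasis (n := 7) 5).toLinearMap ∘ₛₗ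
    spinorConj

theorem realStructureThree_apply (φ : Spinor 3) (i : Fin 2) :
    realStructureThree φ ![i] = Complex.I * (starRingEnd ℂ) (φ ![1 - i]) :=
  (cliffBasis_three (spinorConj φ) i).2.1

theorem quaternionicStructureFive_apply (φ : Spinor 5) (i j : Fin 2) :
    quaternionicStructureFive φ ![i, j]
      = -(bitSign i * bitSign j * (starRingEnd ℂ) (φ ![i, 1 - j])) := by
  have h := (cliffBasis_five (cliffBasis (n := 5) 4 (spinorConj φ)) i j).2.1
  have hc (p : Fin 2 → Fin 2) : spinorConj φ p = (starRingEnd ℂ) (φ p) := rfl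
  refine h.trans ?_
  simp only [cliffBasis_five, hc]
  revert i j
  simp [Fin.forall_fin_two, I_mul_I_mul]

theorem quaternionicStructureSeven_apply (φ : Spinor 7) (i j k : Fin 2) :
    quaternionicStructureSeven φ ![i, j, k]
      = -(Complex.I * bitSign k * (starRingEnd ℂ) (φ ![1 - i, j, 1 - k])) := by
  have h := (cliffBasis_seven (cliffBasis (n := 7) 4 (cliffBasis (n := 7) 5 (spinorConj φ)))
    i j k).2.1
  have hc (p : Fin 3 → Fin 2) : spinorConj φ p = (starRingEnd ℂ) (φ p) := rfl
  refine h.trans ?_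
  simp only [cliffBasis_seven, hc]
  revert i j k
  simp [Fin.forall_fin_two, mul_assoc, I_mul_I_mul]

/-- Conjugation anticommutes with an imaginary `e_a`. For the product `ω` of the `r` imaginary ones,
all of square `-1`, the structure has square `(-1) ^ r ω²`, which is `1` for `r = 1` and `-1` for `r
= 2, 3`. -/
theorem realStructureThree_sq (φ : Spinor 3) : realStructureThree (realStructureThree φ) = φ := by
  refine ext_three fun i => ?_
  simp [realStructureThree_apply, I_mul_I_mul]

theorem quaternionicStructureFive_sq (φ : Spinor 5) :
    quaternionicStructureFive (quaternionicStructureFive φ) = -φ := by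
  refine ext_five fun i j => ?_
  revert i j
  simp [Fin.forall_fin_two, quaternionicStructureFive_apply]

theorem quaternionicStructureSeven_sq (φ : Spinor 7) :
    quaternionicStructureSeven (quaternionicStructureSeven φ) = -φ := by
  refine ext_seven fun i j k => ?_
  revert i j k
  simp [Fin.forall_fin_two, quaternionicStructureSeven_apply, I_mul_I_mul]

/-- With `r` imaginary factors the sign is `(-1) ^ r` for every `a`. A real `e_a` anticommutes with
all `r` factors. An imaginary one anticommutes with the other `r - 1` and with conjugation. -/
theorem realStructureThree_cliffBasis (a : Fin 3) (φ : Spinor 3) :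
    realStructureThree (cliffBasis a φ) = -cliffBasis a (realStructureThree φ) := by
  refine ext_three fun i => ?_
  revert i
  fin_cases a <;>
    simp [Fin.forall_fin_two, realStructureThree_apply, cliffBasis_three]

theorem quaternionicStructureFive_cliffBasis (a : Fin 5) (φ : Spinor 5) :
    quaternionicStructureFive (cliffBasis a φ) = cliffBasis a (quaternionicStructureFive φ) := by
  refine ext_five fun i j => ?_
  revert i j
  fin_cases a <;>
    simp [Fin.forall_fin_two, quaternionicStructureFive_apply, cliffBasis_five]

theorem quaternionicStructureSeven_cliffBasis (a : Fin 7) (φ : Spinor 7) :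
    quaternionicStructureSeven (cliffBasis a φ)
      = -cliffBasis a (quaternionicStructureSeven φ) := by
  refine ext_seven fun i j k => ?_
  revert i j k
  fin_cases a <;>
    simp [Fin.forall_fin_two, quaternionicStructureSeven_apply, cliffBasis_seven]

/-- The matrix of `e₀` is real, so conjugating both spinors conjugates the form, which swaps its
arguments. Each spacelike `e_a` then contributes `⟨e_a φ, e_a ψ⟩ = ⟨φ, e_a² ψ⟩ = -⟨φ, ψ⟩`. -/
theorem spinorForm_realStructureThree (φ ψ : Spinor 3) :
    spinorForm (realStructureThree φ) (realStructureThree ψ) = -spinorForm ψ φ := by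
  simp [spinorForm_three, cliffBasis_three, realStructureThree_apply]
  ring_nf
  simp only [Complex.I_sq]
  ring

theorem spinorForm_quaternionicStructureFive (φ ψ : Spinor 5) :
    spinorForm (quaternionicStructureFive φ) (quaternionicStructureFive ψ) = spinorForm ψ φ := by
  simp [spinorForm_five, cliffBasis_five, quaternionicStructureFive_apply]
  ring

theorem spinorForm_quaternionicStructureSeven (φ ψ : Spinor 7) :
    spinorForm (quaternionicStructureSeven φ) (quaternionicStructureSeven ψ)
      = -spinorForm ψ φ := by
  simp [spinorForm_seven, cliffBasis_seven, quaternionicStructureSeven_apply]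
  ring_nf
  simp only [Complex.I_sq]
  ring

/-! ### The form and Clifford multiplication in arbitrary dimension -/

theorem spinorForm_smul_left {n : ℕ} [NeZero n] (c : ℂ) (φ ψ : Spinor n) :
    spinorForm (c • φ) ψ = c * spinorForm φ ψ := by
  simp [spinorForm]

theorem spinorForm_zero_left {n : ℕ} [NeZero n] (ψ : Spinor n) : spinorForm 0 ψ = 0 := by
  simp [spinorForm]

/-- `⟨e₀ · φ, φ⟩` is the square of the norm of `φ`. -/
theorem spinorForm_cliffBasis_zero {n : ℕ} [NeZero n] (φ : Spinor n) :
    spinorForm (cliffBasis 0 φ) φ = inner ℂ φ φ := by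
  rw [spinorForm, cliffBasis, ← mul_apply_eq_comp, ← map_mul, gamma_sq]
  simp [eta]

theorem act_ι_single {n : ℕ} (a : Fin n) (φ : Spinor n) :
    act (CliffordAlgebra.ι (cliffordForm n) (Pi.single a 1)) φ = cliffBasis a φ := by
  rw [act_ι, Finset.sum_eq_single a] <;> simp +contextual

/-! ### Antilinear maps that commute with vectors up to a sign -/

section Antilinear

variable {n : ℕ} {K : Spinor n →ₗ⋆[ℂ] Spinor n} {s : ℝ}

theorem antilinear_act_ι (hK : ∀ a φ, K (cliffBasis a φ) = (s : ℂ) • cliffBasis a (K φ))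
    (v : Fin n → ℝ) (φ : Spinor n) :
    K (act (CliffordAlgebra.ι (cliffordForm n) v) φ)
      = (s : ℂ) • act (CliffordAlgebra.ι (cliffordForm n) v) (K φ) := by
  simp only [act_ι, map_sum, LinearMap.map_smulₛₗ, Complex.conj_ofReal, Finset.smul_sum]
  refine Finset.sum_congr rfl fun a _ => ?_
  rw [smul_comm]
  exact congrArg _ (hK a φ)

/-- An antilinear map that commutes up to a common sign with Clifford multiplication by vectors
commutes with the spin group. -/
theorem antilinear_act_spin (hs : s * s = 1)
    (hK : ∀ a φ, K (cliffBasis a φ) = (s : ℂ) • cliffBasis a (K φ)) (A : Spin n) (φ : Spinor n) :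
    K (act (A : Cl n) φ) = act (A : Cl n) (K φ) := by
  have key : ∀ B : Cl n, B ∈ CliffordAlgebra.evenOdd (cliffordForm n) 0 →
      K (act B φ) = act B (K φ) := by
    intro B hB
    induction B, hB using CliffordAlgebra.even_induction with
    | algebraMap r =>
      refine (congrArg K (act_algebraMap r φ)).trans (Eq.trans ?_ (act_algebraMap r (K φ)).symm)
      rw [LinearMap.map_smulₛₗ, Complex.conj_ofReal]
    | add _ _ _ _ h1 h2 => rw [act_add, act_add, map_add, h1, h2]
    | ι_mul_ι_mul v w _ _ h =>
      -- Elements of the spin group are even, so vectors come in pairs and the sign `s` cancels.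
      have hs' : (s : ℂ) * s = 1 := mod_cast hs
      simp only [act_mul, antilinear_act_ι hK, h, map_smul, smul_smul, hs', one_smul]
  exact key _ (spinGroup.mem_even A.2)

end Antilinear

/-! ### Transfer from the spinor module to the spinor bundle -/

namespace SpinStructure

variable {n : ℕ} {M : Type*} [TopologicalSpace M] [ChartedSpace (EuclideanSpace ℝ (Fin n)) M]
  [IsManifold (𝓡 n) ∞ M] {g : LorentzianMetric n M} {ι : Type*} (S : SpinStructure g ι)

/-- The antilinear bundle map that is given by a fixed antilinear map in every trivialization. -/
def constAntilinearMap (K : Spinor n →ₗ⋆[ℂ] Spinor n)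
    (hK : ∀ (A : Spin n) (φ : Spinor n), K (act (A : Cl n) φ) = act (A : Cl n) (K φ)) :
    S.AntilinearMap where
  toFun _ := K
  contMDiff := by
    intro p
    have hid := Bundle.contMDiffAt_totalSpace.mp
      (contMDiffAt_id (I := (𝓡 n).prod 𝓘(ℝ, Spinor n)) (n := ∞)
        (x := (p : Bundle.TotalSpace (Spinor n) S.core.Fiber)))
    refine Bundle.contMDiffAt_totalSpace.mpr ⟨hid.1, ?_⟩
    -- `K` is only antilinear over `ℂ`, but it is linear over `ℝ`, hence smooth in finite dimension.
    let K' : Spinor n →ₗ[ℝ] Spinor n :=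
      { toFun := K
        map_add' := map_add K
        map_smul' := fun r φ => by
          rw [← Complex.coe_smul, LinearMap.map_smulₛₗ, Complex.conj_ofReal, Complex.coe_smul]
          rfl }
    have h := (K'.toContinuousLinearMap.contDiff (n := ∞)).contMDiff.contMDiffAt.comp p hid.2
    refine h.congr_of_eventuallyEq (Filter.Eventually.of_forall fun q => ?_)
    -- The fiber at `q` is written in its own trivialization, smoothness is read in that of `p`; the
    -- change between them is the action of a spin element, with which `K` commutes.
    exact (hK _ _).symm

theorem cliff_frame (x : M) (a : Fin n) (φ : S.Fiber x) :
    S.cliff (S.frame (S.indexAt x) x a) φ = cliffBasis a (S.coord φ) := by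
  refine Eq.trans ?_ (act_ι_single a (S.coord φ))
  simp only [cliff]
  congr 3
  ext b
  simp [Pi.single_apply, eq_comm]

theorem cliff_diracCurrent [NeZero n] {x : M} (φ : S.Fiber x) :
    S.cliff (S.diracCurrent φ) φ = currentAct (S.coord φ) := by
  refine (act_ι _ _).trans (Finset.sum_congr rfl fun a _ => ?_)
  -- The coefficients of `diracCurrent` are real parts, those of `currentAct` are not. They agree
  -- since the form is Hermitian and Clifford multiplication symmetric for it.
  have hr : ((S.form (S.cliff (S.frame (S.indexAt x) x a) φ) φ).re : ℂ)
      = spinorForm (cliffBasis a (S.coord φ)) (S.coord φ) := by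
    rw [← S.cliff_frame x a φ]
    refine Complex.conj_eq_iff_re.mp ((spinorForm_conj _ _).trans ?_)
    exact (S.form_cliff _ _ _).symm
  rw [← hr, diracCurrent, Module.Basis.equivFun_apply, Module.Basis.repr_sum_self]
  push_cast
  rfl

theorem val_diracCurrent_self [NeZero n] {x : M} (φ : S.Fiber x) :
    ((g.val x (S.diracCurrent φ) (S.diracCurrent φ) : ℝ) : ℂ)
      = -spinorForm (currentAct (S.coord φ)) (S.coord φ) := by
  rw [S.val_diracCurrent, form, ← S.cliff_diracCurrent]
  rfl

/-- Pairing the current with the timelike frame vector gives `-|φ|²`. -/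
theorem diracCurrent_ne_zero [NeZero n] {x : M} {φ : S.Fiber x} (hφ : φ ≠ 0) :
    S.diracCurrent φ ≠ 0 := by
  intro h
  have h0 := S.val_diracCurrent φ (S.frame (S.indexAt x) x 0)
  rw [h, map_zero, zero_apply, Complex.ofReal_zero, form, S.cliff_frame] at h0
  refine hφ (inner_self_eq_zero.mp ((spinorForm_cliffBasis_zero (S.coord φ)).symm.trans ?_))
  exact neg_eq_zero.mp h0.symm

theorem antilinear_cliff {K : Spinor n →ₗ⋆[ℂ] Spinor n} {s : ℝ}
    (hK : ∀ a φ, K (cliffBasis a φ) = (s : ℂ) • cliffBasis a (K φ)) {x : M}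
    (X : TangentSpace (𝓡 n) x) (φ : S.Fiber x) :
    K (S.coord (S.cliff X φ)) = (s : ℂ) • S.coord (S.cliff X (K (S.coord φ))) :=
  antilinear_act_ι hK _ _

/-- If `V_φ · φ = ⟨φ, φ⟩ φ` then `g (V_φ, V_φ) = -⟨φ, φ⟩²`. -/
theorem val_diracCurrent_self_of_currentAct_eq [NeZero n] {x : M} {φ : S.Fiber x}
    (h : currentAct (S.coord φ) = spinorForm (S.coord φ) (S.coord φ) • S.coord φ) :
    ((g.val x (S.diracCurrent φ) (S.diracCurrent φ) : ℝ) : ℂ) = -(S.form φ φ) ^ 2 := by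
  rw [S.val_diracCurrent_self, h, spinorForm_smul_left, form, sq]

/-- If `V_φ · φ = 0` then `V_φ` is lightlike. -/
theorem val_diracCurrent_self_of_currentAct_eq_zero [NeZero n] {x : M} {φ : S.Fiber x}
    (h : currentAct (S.coord φ) = 0) : g.val x (S.diracCurrent φ) (S.diracCurrent φ) = 0 := by
  have hv := S.val_diracCurrent_self φ
  rw [h, spinorForm_zero_left, neg_zero] at hv
  exact_mod_cast hv

end SpinStructure

end LorentzSpin

end

/-! ### The theorem, assembled dimension by dimension -/

theorem mainTheorem6 {n : ℕ} [NeZero n] {M : Type*} [TopologicalSpace M]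
    [ChartedSpace (EuclideanSpace ℝ (Fin n)) M] [IsManifold (𝓡 n) ∞ M]
    (g : LorentzSpin.LorentzianMetric n M) {ι : Type*} (S : LorentzSpin.SpinStructure g ι) :
    (n = 3 → ∃ τ : S.RealStructure,
      (∀ (x : M) (X : TangentSpace (𝓡 n) x) (φ : S.Fiber x),
        τ.toFun x (S.cliff X φ) = -S.cliff X (τ.toFun x φ)) ∧
      (∀ (x : M) (φ ψ : S.Fiber x),
        S.form (τ.toFun x φ) (τ.toFun x ψ) = -S.form ψ φ) ∧
      (∀ (x : M) (φ : S.Fiber x),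
        S.cliff (S.diracCurrent φ) φ = S.form φ φ • φ ∧
        ((g.val x (S.diracCurrent φ) (S.diracCurrent φ) : ℝ) : ℂ) = -(S.form φ φ) ^ 2) ∧
      (∀ (x : M) (φ : S.Fiber x), τ.toFun x φ = φ →
        g.val x (S.diracCurrent φ) (S.diracCurrent φ) = 0 ∧
        (φ ≠ 0 → S.diracCurrent φ ≠ 0))) ∧
    (n = 5 → ∃ J : S.QuaternionicStructure,
      (∀ (x : M) (X : TangentSpace (𝓡 n) x) (φ : S.Fiber x),
        J.toFun x (S.cliff X φ) = S.cliff X (J.toFun x φ)) ∧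
      (∀ (x : M) (φ ψ : S.Fiber x),
        S.form (J.toFun x φ) (J.toFun x ψ) = S.form ψ φ) ∧
      (∀ (x : M) (φ : S.Fiber x),
        S.cliff (S.diracCurrent φ) φ = S.form φ φ • φ ∧
        ((g.val x (S.diracCurrent φ) (S.diracCurrent φ) : ℝ) : ℂ) = -(S.form φ φ) ^ 2)) ∧
    (n = 7 → ∃ J : S.QuaternionicStructure,
      (∀ (x : M) (X : TangentSpace (𝓡 n) x) (φ : S.Fiber x),
        J.toFun x (S.cliff X φ) = -S.cliff X (J.toFun x φ)) ∧
      (∀ (x : M) (φ ψ : S.Fiber x),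
        S.form (J.toFun x φ) (J.toFun x ψ) = -S.form ψ φ) ∧
      (∀ (x : M) (φ : S.Fiber x),
        S.cliff (S.diracCurrent φ) φ = S.form φ φ • φ + S.form φ (J.toFun x φ) • J.toFun x φ ∧
        ‖S.form φ φ‖ ^ 2 + ‖S.form φ (J.toFun x φ)‖ ^ 2
          = -g.val x (S.diracCurrent φ) (S.diracCurrent φ))) ∧
    (n = 2 ∨ n = 4 ∨ n = 6 → ∀ (ε : ℤˣ) (x : M) (φ : S.Fiber x), φ ∈ S.half ε x →
      S.cliff (S.diracCurrent φ) φ = 0 ∧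
      g.val x (S.diracCurrent φ) (S.diracCurrent φ) = 0 ∧
      (φ ≠ 0 → S.diracCurrent φ ≠ 0)) := by
  refine ⟨?_, ?_, ?_, ?_⟩
  · rintro rfl
    have hK : ∀ a φ, LorentzSpin.realStructureThree (LorentzSpin.cliffBasis a φ)
        = ((-1 : ℝ) : ℂ) • LorentzSpin.cliffBasis a (LorentzSpin.realStructureThree φ) := by
      simp [LorentzSpin.realStructureThree_cliffBasis]
    have hform : ∀ (x : M) (φ ψ : S.Fiber x), S.form (x := x)
        (LorentzSpin.realStructureThree φ) (LorentzSpin.realStructureThree ψ) = -S.form ψ φ :=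
      fun x φ ψ => LorentzSpin.spinorForm_realStructureThree φ ψ
    have hnorm : ∀ (x : M) (φ : S.Fiber x),
        ((g.val x (S.diracCurrent φ) (S.diracCurrent φ) : ℝ) : ℂ) = -(S.form φ φ) ^ 2 :=
      fun x φ => S.val_diracCurrent_self_of_currentAct_eq (LorentzSpin.currentAct_three _)
    refine ⟨{ S.constAntilinearMap LorentzSpin.realStructureThree
        (LorentzSpin.antilinear_act_spin (s := -1) (by norm_num) hK) with
        sq := fun x φ => LorentzSpin.realStructureThree_sq φ }, fun x X φ => ?_, hform,
      fun x φ => ⟨(S.cliff_diracCurrent φ).trans (LorentzSpin.currentAct_three _), hnorm x φ⟩,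
      fun x φ hφ => ⟨?_, fun h => S.diracCurrent_ne_zero h⟩⟩
    · refine (S.antilinear_cliff hK X φ).trans ?_
      rw [Complex.ofReal_neg, Complex.ofReal_one, neg_smul, one_smul]
      rfl
    -- For `τφ = φ` the compatibility of `τ` with the form reads `⟨φ, φ⟩ = -⟨φ, φ⟩`.
    · have h0 : S.form φ φ = 0 := by
        have h := hform x φ φ
        change LorentzSpin.realStructureThree φ = φ at hφ
        rw [hφ] at h
        exact self_eq_neg.mp h
      have h := hnorm x φ
      rw [h0] at h
      simpa using h
  · rintro rfl
    have hK : ∀ a φ, LorentzSpin.quaternionicStructureFive (LorentzSpin.cliffBasis a φ)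
        = ((1 : ℝ) : ℂ) •
          LorentzSpin.cliffBasis a (LorentzSpin.quaternionicStructureFive φ) := by
      simp [LorentzSpin.quaternionicStructureFive_cliffBasis]
    refine ⟨{ S.constAntilinearMap LorentzSpin.quaternionicStructureFive
        (LorentzSpin.antilinear_act_spin (s := 1) (by norm_num) hK) with
        sq := fun x φ => LorentzSpin.quaternionicStructureFive_sq φ }, fun x X φ => ?_,
      fun x φ ψ => LorentzSpin.spinorForm_quaternionicStructureFive φ ψ,
      fun x φ => ⟨(S.cliff_diracCurrent φ).trans (LorentzSpin.currentAct_five _),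
        S.val_diracCurrent_self_of_currentAct_eq (LorentzSpin.currentAct_five _)⟩⟩
    refine (S.antilinear_cliff hK X φ).trans ?_
    rw [Complex.ofReal_one, one_smul]
    rfl
  · rintro rfl
    have hK : ∀ a φ, LorentzSpin.quaternionicStructureSeven (LorentzSpin.cliffBasis a φ)
        = ((-1 : ℝ) : ℂ) •
          LorentzSpin.cliffBasis a (LorentzSpin.quaternionicStructureSeven φ) := by
      simp [LorentzSpin.quaternionicStructureSeven_cliffBasis]
    refine ⟨{ S.constAntilinearMap LorentzSpin.quaternionicStructureSeven
        (LorentzSpin.antilinear_act_spin (s := -1) (by norm_num) hK) with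
        sq := fun x φ => LorentzSpin.quaternionicStructureSeven_sq φ }, fun x X φ => ?_,
      fun x φ ψ => LorentzSpin.spinorForm_quaternionicStructureSeven φ ψ,
      fun x φ => ⟨(S.cliff_diracCurrent φ).trans (LorentzSpin.currentAct_seven _), ?_⟩⟩
    · refine (S.antilinear_cliff hK X φ).trans ?_
      rw [Complex.ofReal_neg, Complex.ofReal_one, neg_smul, one_smul]
      rfl
    · have hv := S.val_diracCurrent_self φ
      rw [LorentzSpin.currentAct_seven, LorentzSpin.spinorForm_add_left,
        LorentzSpin.spinorForm_smul_left, LorentzSpin.spinorForm_smul_left] at hv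
      rw [← Complex.ofReal_inj, Complex.ofReal_neg, hv, neg_neg]
      push_cast
      -- The other side is `⟨φ, φ⟩⟨φ, φ⟩ + ⟨φ, Jφ⟩⟨Jφ, φ⟩`; by Hermitian symmetry each product has
      -- the form `z` times its conjugate.
      rw [← Complex.mul_conj', ← Complex.mul_conj']
      congr 2
      · exact LorentzSpin.spinorForm_conj _ _
      · exact LorentzSpin.spinorForm_conj _ _
  · rintro hn ε x φ hφ
    have h0 : LorentzSpin.currentAct (S.coord φ) = 0 := by
      rcases hn with rfl | rfl | rfl
      · exact LorentzSpin.currentAct_two hφ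
      · exact LorentzSpin.currentAct_four hφ
      · exact LorentzSpin.currentAct_six hφ
    exact ⟨(S.cliff_diracCurrent φ).trans h0, S.val_diracCurrent_self_of_currentAct_eq_zero h0,
      fun h => S.diracCurrent_ne_zero h⟩
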